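/- Let $\mathbb E$ be a complex normed space, $q$ a continuous semi-norm on $\mathbb E$, and $\mathbb D=\{x\in\mathbb E: q(x)<1\}$. For every $x\in\mathbb D$ let $\phi_x$ be an automorphism of $\mathbb D$ (a holomorphic bijection of $\mathbb D$ onto itself with holomorphic inverse, where holomorphic means locally given by a convergent power series) such that $\phi_x(x)=0$. For $t\in[0,1]$ and $z\in\mathbb D$ put $t\otimes z=\phi_0^{-1}(t\,\phi_0(z))$. Let $d$ be the Kobayashi pseudodistance of $\mathbb D$: $d(x,y)$ is the infimum of $\int_0^1 g(\gamma(t),\gamma'(t))\,dt$ over all piecewise $C^1$ curves $\gamma:[0,1]\to\mathbb D$ from $x$ to $y$, where $g(x,v)$ is the infimum of $1/\tau$ over all $\tau>0$ for which there is a holomorphic map $h$ from the open unit disc of $\mathbb C$ to $\mathbb D$ with $h(0)=x$ and $h'(0)=\tau v$. For $x,y\in\mathbb D$, an almost geodesic joining $x$ and $y$ is a curve $$\gamma_{x,y}(t)=\phi_x^{-1}\big(\alpha(t)\otimes\phi_x(y)\big),\qquad t\in[0,1],$$ where $\alpha:[0,1]\to[0,1]$ is a solution of the defining equation $$d\big(0,\alpha(t)\otimes\phi_x(y)\big)=t\,d\big(0,\phi_x(y)\big)\quad\text{for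 all }t\in[0,1].$$ Let $x,y\in\mathbb D$ and $s=q(\phi_x(y))$. Then: 1. There is a continuous solution $\alpha:[0,1]\to[0,1]$ of the defining equation whose almost geodesic $\gamma_{x,y}$ takes values in $\mathbb D$ and satisfies $\gamma_{x,y}(0)=x$ and $\gamma_{x,y}(1)=y$. 2. A function $\alpha:[0,1]\to[0,1]$ is a solution of the defining equation if and only if $$q\big(\alpha(t)\otimes\phi_x(y)\big)=\frac{(1+s)^t-(1-s)^t}{(1+s)^t+(1-s)^t}\quad\text{for all }t\in[0,1].$$ Thus the almost geodesics joining $x$ and $y$ are exactly the curves $t\mapsto\phi_x^{-1}(\alpha(t)\otimes\phi_x(y))$ with $\alpha:[0,1]\to[0,1]$ satisfying this formula. 3. If moreover $\phi_0(tw)=t\,\phi_0(w)$ for all $w\in\mathbb D$ and $t\in[0,1]$, and $s>0$, then the defining equation has exactly one solution $\alpha:[0,1]\to[0,1]$, namely $$\alpha(t)=\frac1s\cdot\frac{(1+s)^t-(1-s)^t}{(1+s)^t+(1-s)^t},\qquad t\in[0,1].$$ -/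

import Mathlib

open Set MeasureTheory

namespace ComplexDomain

variable {E : Type*} [NormedAddCommGroup E] [NormedSpace ℂ E]

/-- `γ` restricted to `[0,1]` is a piecewise continuously differentiable curve: there is a
partition `0 = p 0 < p 1 < ⋯ < p n = 1` such that `γ` is of class `C¹` on every closed
subinterval `[p i, p (i+1)]` (one-sided derivatives at its end points). In particular
`γ` is continuous on `[0,1]`. -/
def IsPiecewiseC1 (γ : ℝ → E) : Prop :=
  ∃ (n : ℕ) (p : ℕ → ℝ), p 0 = 0 ∧ p n = 1 ∧
    ∀ i < n, p i < p (i + 1) ∧ ContDiffOn ℝ 1 γ (Icc (p i) (p (i + 1)))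

/-- The Kobayashi differential metric of `D` at the point `x` in the direction `v`: the infimum
of `1 / τ` over all `τ > 0` for which there is a holomorphic map `h` from the open unit disc
of `ℂ` to `D` with `h 0 = x` and `h' 0 = τ v`. (Holomorphic means locally given by a
convergent power series.) -/
noncomputable def kobayashiMetric (D : Set E) (x v : E) : ENNReal :=
  sInf {c : ENNReal | ∃ (τ : ℝ) (h : ℂ → E), 0 < τ ∧
    AnalyticOnNhd ℂ h (Metric.ball 0 1) ∧ MapsTo h (Metric.ball 0 1) D ∧
    h 0 = x ∧ HasDerivAt h (τ • v) 0 ∧ c = ENNReal.ofReal (1 / τ)}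

/-- The integrated form of a differential metric `g` on `D`: the infimum of the lengths
`∫ g(γ(t), γ'(t)) dt` over all piecewise `C¹` curves `γ : [0,1] → D` from `x` to `y`.
The values are extended nonnegative reals, so that no integrability convention enters; the
finitely many `t` where `γ` has no derivative do not matter. -/
noncomputable def integratedForm (D : Set E) (g : E → E → ENNReal) (x y : E) : ENNReal :=
  sInf {L : ENNReal | ∃ γ : ℝ → E, IsPiecewiseC1 γ ∧ MapsTo γ (Icc 0 1) D ∧
    γ 0 = x ∧ γ 1 = y ∧ L = ∫⁻ t in Icc (0 : ℝ) 1, g (γ t) (deriv γ t)}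

/-- The Kobayashi pseudodistance of `D`. -/
noncomputable def kobayashiDist (D : Set E) (x y : E) : ENNReal :=
  integratedForm D (kobayashiMetric D) x y

/-- `f`, with its inverse `f.symm`, is an automorphism of the open set `D`: a bijection of `D`
onto itself which is holomorphic together with its inverse. -/
structure IsAutomorphism (D : Set E) (f : PartialEquiv E E) : Prop where
  source_eq : f.source = D
  target_eq : f.target = D
  holomorphic : AnalyticOnNhd ℂ f D
  holomorphic_symm : AnalyticOnNhd ℂ f.symm D

/-- The scalar multiplication `t ⊗ x = φ_o⁻¹ (t φ_o(x))` with respect to the family of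
automorphisms `φ` and the identity element `o`. -/
noncomputable def scalarMul (φ : E → PartialEquiv E E) (o : E) (t : ℝ) (x : E) : E :=
  (φ o).symm (t • φ o x)

/-- `α` maps `[0,1]` to `[0,1]` and solves the defining equation of almost geodesics,
`d(o, α(t) ⊗ φ_x(y)) = t d(o, φ_x(y))` for all `t ∈ [0,1]`. -/
def SolvesGeodesicEquation (d : E → E → ENNReal) (φ : E → PartialEquiv E E) (o x y : E)
    (α : ℝ → ℝ) : Prop :=
  MapsTo α (Icc 0 1) (Icc 0 1) ∧
    ∀ t ∈ Icc (0 : ℝ) 1,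
      d o (scalarMul φ o (α t) (φ x y)) = ENNReal.ofReal t * d o (φ x y)

/-- The curve `t ↦ φ_x⁻¹ (α(t) ⊗ φ_x(y))`. -/
noncomputable def geodesicCurve (φ : E → PartialEquiv E E) (o x y : E) (α : ℝ → ℝ) (t : ℝ) : E :=
  (φ x).symm (scalarMul φ o (α t) (φ x y))

/-- `γ`, restricted to `[0,1]`, is an almost geodesic joining `x` and `y`, with respect to the
distance `d`: it is `t ↦ φ_x⁻¹ (α(t) ⊗ φ_x(y))` for a solution `α` of the defining equation. -/
def IsAlmostGeodesic (d : E → E → ENNReal) (φ : E → PartialEquiv E E) (o x y : E)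
    (γ : ℝ → E) : Prop :=
  ∃ α : ℝ → ℝ, SolvesGeodesicEquation d φ o x y α ∧
    ∀ t ∈ Icc (0 : ℝ) 1, γ t = geodesicCurve φ o x y α t

end ComplexDomain

/-! Everything reduces to the identity `d(0, z) = artanh (q z)` on the seminorm ball. For the lower
bound, Hahn–Banach gives a functional `f` with `f z = q z` and `‖f‖ ≤ q`; it maps the ball into the
unit disc, so Schwarz–Pick bounds the metric below and integration along a curve gives `artanh`. For
the upper bound, Möbius discs in the direction `z` estimate the length of the segment from `0` to
`z`. By the Schwarz lemma, `φ 0` and its inverse preserve `q`, hence `q (a ⊗ w) = a * q w`. The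
defining equation thus reads `q (α t ⊗ φ x y) = tanh (t * artanh s)`, and rewriting `tanh` by powers
gives the formula. If `s > 0`, dividing by `s` determines `α`. -/

namespace ComplexDomain

/-! ### Integrals for `artanh` and Schwarz–Pick on the disc -/

theorem _root_.Real.hasDerivAt_artanh {x : ℝ} (hx : x ∈ Ioo (-1) 1) :
    HasDerivAt Real.artanh (1 / (1 - x ^ 2)) x := by
  have h1 : 0 < 1 - x := by linarith [hx.2]
  have h2 : 0 < 1 + x := by linarith [hx.1]
  have h3 : 1 - x ^ 2 ≠ 0 := by nlinarith
  have key : HasDerivAt (fun y : ℝ => 1 / 2 * Real.log ((1 + y) / (1 - y))) (1 / (1 - x ^ 2)) x := by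
    have ha : HasDerivAt (fun y : ℝ => 1 + y) 1 x := (hasDerivAt_id x).const_add 1
    have hb : HasDerivAt (fun y : ℝ => 1 - y) (-1) x := (hasDerivAt_id x).const_sub 1
    have := (((ha.div hb h1.ne').log (div_pos h2 h1).ne').const_mul (1 / 2))
    refine this.congr_deriv ?_
    rw [Pi.div_apply]
    field_simp
    ring
  refine key.congr_of_eventuallyEq ?_
  filter_upwards [Ioo_mem_nhds hx.1 hx.2] with y hy
  exact Real.artanh_eq_half_log (Ioo_subset_Icc_self hy)

theorem ofReal_artanh_sub_le_lintegral {u : ℝ → ℝ} {S : Set ℝ} (hS : S.Countable)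
    (hc : ContinuousOn u (Icc 0 1)) (hd : ∀ t ∈ Ioo (0 : ℝ) 1 \ S, DifferentiableAt ℝ u t)
    (hu : MapsTo u (Icc 0 1) (Ioo (-1) 1)) :
    ENNReal.ofReal (Real.artanh (u 1) - Real.artanh (u 0)) ≤
      ∫⁻ t in Icc (0 : ℝ) 1, ENNReal.ofReal (|deriv u t| / (1 - u t ^ 2)) := by
  set G : ℝ → ℝ := fun t => deriv u t / (1 - u t ^ 2) with hG
  have hpos : ∀ t ∈ Icc (0 : ℝ) 1, 0 < 1 - u t ^ 2 := fun t ht => by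
    have := hu ht
    nlinarith [this.1, this.2]
  have hGm : AEStronglyMeasurable G (volume.restrict (Icc 0 1)) := by
    have h1 : AEMeasurable (deriv u) (volume.restrict (Icc 0 1)) :=
      (measurable_deriv u).aemeasurable
    have h2 : AEMeasurable u (volume.restrict (Icc 0 1)) := hc.aemeasurable measurableSet_Icc
    exact (h1.div ((h2.pow_const 2).const_sub 1)).aestronglyMeasurable
  have heq : ∫⁻ t in Icc (0 : ℝ) 1, ENNReal.ofReal (|deriv u t| / (1 - u t ^ 2)) =
      ∫⁻ t in Icc (0 : ℝ) 1, ‖G t‖ₑ := by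
    refine setLIntegral_congr_fun measurableSet_Icc fun t ht => ?_
    simp only [hG]
    rw [← ofReal_norm, Real.norm_eq_abs, abs_div, abs_of_pos (hpos t ht)]
  rw [heq]
  -- An infinite integral leaves nothing to prove; a finite one supplies the integrability that the
  -- fundamental theorem of calculus needs.
  rcases eq_or_ne (∫⁻ t in Icc (0 : ℝ) 1, ‖G t‖ₑ) ⊤ with htop | htop
  · rw [htop]; exact le_top
  have hGi : IntegrableOn G (Icc 0 1) := ⟨hGm, lt_top_iff_ne_top.2 htop⟩
  have hint : ∫ t in (0 : ℝ)..1, G t = Real.artanh (u 1) - Real.artanh (u 0) := by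
    refine integral_eq_of_hasDerivAt_off_countable_of_le (fun t => Real.artanh (u t)) G zero_le_one
      hS ?_ ?_ ?_
    · exact fun t ht => (Real.hasDerivAt_artanh (hu ht)).continuousAt.comp_continuousWithinAt (hc t ht)
    · intro t ht
      have := (Real.hasDerivAt_artanh (hu (Ioo_subset_Icc_self ht.1))).comp t (hd t ht).hasDerivAt
      refine this.congr_deriv ?_
      simp only [hG]
      ring
    · rw [intervalIntegrable_iff_integrableOn_Icc_of_le zero_le_one]
      exact hGi
  rw [intervalIntegral.integral_of_le zero_le_one, ← integral_Icc_eq_integral_Ioc] at hint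
  rw [← hint]
  refine le_trans ?_ (enorm_integral_le_lintegral_enorm _)
  exact Real.ofReal_le_enorm _

theorem lintegral_artanh_deriv {r : ℝ} (hr0 : 0 ≤ r) (hr1 : r < 1) :
    ∫⁻ t in Icc (0 : ℝ) 1, ENNReal.ofReal (r / (1 - (t * r) ^ 2)) =
      ENNReal.ofReal (Real.artanh r) := by
  have hmem : ∀ t ∈ Icc (0 : ℝ) 1, t * r ∈ Ioo (-1 : ℝ) 1 := fun t ht =>
    ⟨by nlinarith [ht.1, ht.2], by nlinarith [ht.1, ht.2]⟩
  have hpos : ∀ t ∈ Icc (0 : ℝ) 1, 0 < 1 - (t * r) ^ 2 := fun t ht => by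
    nlinarith [(hmem t ht).1, (hmem t ht).2]
  have hcont : ContinuousOn (fun t : ℝ => r / (1 - (t * r) ^ 2)) (Icc 0 1) :=
    continuousOn_const.div (by fun_prop) fun t ht => (hpos t ht).ne'
  have hint : ∫ t in (0 : ℝ)..1, r / (1 - (t * r) ^ 2) = Real.artanh r := by
    have := intervalIntegral.integral_eq_sub_of_hasDerivAt (a := 0) (b := 1)
      (f := fun t => Real.artanh (t * r)) (f' := fun t : ℝ => r / (1 - (t * r) ^ 2)) ?_ ?_
    · simpa using this
    · intro t ht
      rw [uIcc_of_le zero_le_one] at ht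
      have := (Real.hasDerivAt_artanh (hmem t ht)).comp t ((hasDerivAt_id t).mul_const r)
      refine this.congr_deriv ?_
      ring
    · refine ContinuousOn.intervalIntegrable ?_
      rwa [uIcc_of_le zero_le_one]
  rw [intervalIntegral.integral_of_le zero_le_one, ← integral_Icc_eq_integral_Ioc] at hint
  rw [← hint, ofReal_integral_eq_lintegral_ofReal hcont.integrableOn_Icc]
  exact (ae_restrict_iff' measurableSet_Icc).2
    (Filter.Eventually.of_forall fun t ht => div_nonneg hr0 (hpos t ht).le)

/-- The **Schwarz–Pick lemma** at the centre of the unit disc. -/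
theorem norm_deriv_le_one_sub_sq {g : ℂ → ℂ} {b : ℂ}
    (hg : DifferentiableOn ℂ g (Metric.ball 0 1))
    (hmaps : MapsTo g (Metric.ball 0 1) (Metric.ball 0 1)) (hb : HasDerivAt g b 0) :
    ‖b‖ ≤ 1 - ‖g 0‖ ^ 2 := by
  set a := g 0 with ha
  have hmem0 : (0 : ℂ) ∈ Metric.ball (0 : ℂ) 1 := by simp
  have ha1 : ‖a‖ < 1 := by simpa using hmaps hmem0
  have hden : ∀ w : ℂ, ‖w‖ < 1 → 1 - (starRingEnd ℂ) a * w ≠ 0 := fun w hw h => by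
    have h1 : ‖(starRingEnd ℂ) a * w‖ = 1 := by rw [← sub_eq_zero.1 h, norm_one]
    rw [norm_mul, RCLike.norm_conj] at h1
    nlinarith [norm_nonneg a, norm_nonneg w]
  have hball : ∀ ζ ∈ Metric.ball (0 : ℂ) 1, ‖g ζ‖ < 1 := fun ζ hζ => by simpa using hmaps hζ
  -- Following `g` by the disc automorphism that sends `a` to `0` reduces the claim to the Schwarz
  -- lemma.
  set F : ℂ → ℂ := fun ζ => (g ζ - a) / (1 - (starRingEnd ℂ) a * g ζ) with hF
  have hF0 : F 0 = 0 := by simp [hF, ha]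
  have hFd : DifferentiableOn ℂ F (Metric.ball 0 1) :=
    (hg.sub_const a).div ((hg.const_mul _).const_sub 1) fun ζ hζ => hden _ (hball ζ hζ)
  have hFm : MapsTo F (Metric.ball 0 1) (Metric.closedBall (F 0) 1) := by
    intro ζ hζ
    rw [hF0, mem_closedBall_zero_iff, norm_div]
    have hw := hball ζ hζ
    refine div_le_one_of_le₀ ?_ (norm_nonneg _)
    rw [← sq_le_sq₀ (norm_nonneg _) (norm_nonneg _)]
    have hw2 : ‖g ζ‖ ^ 2 < 1 := by nlinarith [norm_nonneg (g ζ)]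
    have ha2 : ‖a‖ ^ 2 < 1 := by nlinarith [norm_nonneg a]
    rw [Complex.sq_norm, Complex.normSq_apply] at hw2 ha2
    rw [Complex.sq_norm, Complex.sq_norm, Complex.normSq_apply, Complex.normSq_apply]
    simp only [Complex.sub_re, Complex.sub_im, Complex.mul_re, Complex.mul_im, Complex.conj_re,
      Complex.conj_im, Complex.one_re, Complex.one_im]
    -- |1 - āw|² - |w - a|² = (1 - |w|²)(1 - |a|²), with w = `g ζ`.
    nlinarith [mul_pos (sub_pos.2 hw2) (sub_pos.2 ha2)]
  have hFder : HasDerivAt F (b / (1 - ‖a‖ ^ 2)) 0 := by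
    have h := (hb.sub_const a).div ((hb.const_mul ((starRingEnd ℂ) a)).const_sub 1)
      (hden _ (hball 0 hmem0))
    have e : (starRingEnd ℂ) a * a = (‖a‖ : ℂ) ^ 2 := Complex.conj_mul' a
    refine h.congr_deriv ?_
    rw [← ha, e, sub_self, zero_mul, sub_zero]
    have : (1 - (‖a‖ : ℂ) ^ 2) ≠ 0 := e ▸ hden a ha1
    field_simp
  have key := Complex.norm_deriv_le_one_of_mapsTo_ball hFd hFm one_pos
  have hpos : 0 < 1 - ‖a‖ ^ 2 := by nlinarith [norm_nonneg a]
  have e2 : ‖(1 - (‖a‖ : ℂ) ^ 2)‖ = 1 - ‖a‖ ^ 2 := by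
    have : (1 - (‖a‖ : ℂ) ^ 2) = ((1 - ‖a‖ ^ 2 : ℝ) : ℂ) := by push_cast; rfl
    rw [this, Complex.norm_real, Real.norm_of_nonneg hpos.le]
  rw [hFder.deriv, norm_div, e2] at key
  exact (div_le_one hpos).1 key

/-! ### Lower bound through linear functionals -/

variable {E : Type*} [NormedAddCommGroup E] [NormedSpace ℂ E]

theorem _root_.Seminorm.exists_strongDual_apply_eq {q : Seminorm ℂ E} (hq : Continuous q) (z : E) :
    ∃ f : StrongDual ℂ E, f z = q z ∧ ∀ x, ‖f x‖ ≤ q x := by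
  rcases eq_or_ne z 0 with rfl | hz
  · exact ⟨0, by simp, by simp⟩
  obtain ⟨f, hf, hle⟩ := Module.Dual.exists_continuous_extension_of_le_seminorm
    (Submodule.span ℂ {z}) ((q z : ℂ) • (LinearEquiv.coord ℂ E z hz : _ →ₗ[ℂ] ℂ)) hq (fun x => by
      have hx : LinearEquiv.coord ℂ E z hz x • z = x := LinearEquiv.coord_apply_smul ℂ E z hz x
      conv_rhs => rw [← hx, map_smul_eq_mul]
      simp [mul_comm, abs_of_nonneg])
  refine ⟨f, ?_, hle⟩
  have := hf ⟨z, Submodule.mem_span_singleton_self z⟩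
  simpa [LinearEquiv.coord_self] using this

/-- Schwarz–Pick for `f ∘ h` gives τ|f v| ≤ 1 - |f x|². Passing to real parts only weakens this, and
leaves a real integrand with primitive `artanh`. -/
theorem ofReal_div_le_kobayashiMetric {D : Set E} (f : StrongDual ℂ E)
    (hf : ∀ x ∈ D, ‖f x‖ < 1) (x v : E) :
    ENNReal.ofReal (|(f v).re| / (1 - (f x).re ^ 2)) ≤ kobayashiMetric D x v := by
  refine le_sInf ?_
  rintro c ⟨τ, h, hτ, hh, hmaps, h0, hd, rfl⟩
  have hx : ‖f x‖ < 1 := by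
    rw [← h0]; exact hf _ (hmaps (by simp))
  have key := norm_deriv_le_one_sub_sq (g := fun ζ => f (h ζ)) (b := f (τ • v))
    (fun ζ hζ => (f.differentiableAt.comp ζ (hh ζ hζ).differentiableAt).differentiableWithinAt)
    (fun ζ hζ => by simpa using hf _ (hmaps hζ)) (f.hasFDerivAt.comp_hasDerivAt 0 hd)
  have e : f (τ • v) = τ • f v := (f.restrictScalars ℝ).map_smul τ v
  rw [e, norm_smul, Real.norm_of_nonneg hτ.le, h0] at key
  have h1 := Complex.abs_re_le_norm (f v)
  have h2 : (f x).re ^ 2 ≤ ‖f x‖ ^ 2 := by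
    rw [← sq_abs]; gcongr; exact Complex.abs_re_le_norm _
  have h3 : ‖f x‖ ^ 2 < 1 := by nlinarith [norm_nonneg (f x)]
  refine ENNReal.ofReal_le_ofReal ?_
  rw [div_le_div_iff₀ (by linarith) hτ]
  nlinarith

theorem IsPiecewiseC1.continuousOn_and_differentiableAt {γ : ℝ → E} (hγ : IsPiecewiseC1 γ) :
    ContinuousOn γ (Icc 0 1) ∧
      ∃ S : Set ℝ, S.Countable ∧ ∀ t ∈ Ioo (0 : ℝ) 1 \ S, DifferentiableAt ℝ γ t := by
  obtain ⟨n, p, hp0, hpn, hp⟩ := hγ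
  have key : ∀ m ≤ n, 0 ≤ p m ∧ ContinuousOn γ (Icc 0 (p m)) ∧
      ∀ t ∈ Ioo 0 (p m) \ range p, DifferentiableAt ℝ γ t := by
    intro m
    induction m with
    | zero =>
      intro _
      rw [hp0]
      simp
    | succ k ih =>
      intro hk
      obtain ⟨h0, h1, h2⟩ := ih (by omega)
      obtain ⟨hlt, hC⟩ := hp k (by omega)
      refine ⟨h0.trans hlt.le, ?_, ?_⟩
      · rw [← Icc_union_Icc_eq_Icc h0 hlt.le]
        exact h1.union_of_isClosed hC.continuousOn isClosed_Icc isClosed_Icc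
      · rintro t ⟨ht, htp⟩
        rcases lt_trichotomy t (p k) with h | h | h
        · exact h2 t ⟨⟨ht.1, h⟩, htp⟩
        · exact absurd ⟨k, h.symm⟩ htp
        · exact (hC.contDiffAt (Icc_mem_nhds h ht.2)).differentiableAt one_ne_zero
  obtain ⟨-, h1, h2⟩ := key n le_rfl
  rw [hpn] at h1 h2
  exact ⟨h1, range p, countable_range p, h2⟩

theorem ofReal_artanh_sub_le_kobayashiDist {D : Set E} (f : StrongDual ℂ E)
    (hf : ∀ x ∈ D, ‖f x‖ < 1) (x y : E) :
    ENNReal.ofReal (Real.artanh (f y).re - Real.artanh (f x).re) ≤ kobayashiDist D x y := by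
  refine le_sInf ?_
  rintro L ⟨γ, hγ, hmaps, rfl, rfl, rfl⟩
  obtain ⟨hc, S, hS, hd⟩ := hγ.continuousOn_and_differentiableAt
  have hder : ∀ t ∈ Ioo (0 : ℝ) 1 \ S,
      HasDerivAt (fun t => (f (γ t)).re) (f (deriv γ t)).re t := fun t ht =>
    ((Complex.reCLM.comp (f.restrictScalars ℝ)).hasFDerivAt).comp_hasDerivAt t (hd t ht).hasDerivAt
  refine (ofReal_artanh_sub_le_lintegral (u := fun t => (f (γ t)).re) hS ?_
    (fun t ht => (hder t ht).differentiableAt) ?_).trans ?_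
  · exact (Complex.continuous_re.comp f.continuous).comp_continuousOn hc
  · intro t ht
    exact abs_lt.1 ((Complex.abs_re_le_norm _).trans_lt (hf _ (hmaps ht)))
  · refine lintegral_mono_ae ?_
    -- The break points and the ends of `[0,1]`, where `γ` may lack a two-sided derivative, form a
    -- null set.
    have h0 : ∀ᵐ t : ℝ ∂volume.restrict (Icc 0 1), t ∉ S ∪ {0, 1} :=
      ae_restrict_of_ae ((hS.union (toFinite {0, 1}).countable).ae_notMem _)
    filter_upwards [h0, ae_restrict_mem measurableSet_Icc] with t htS ht
    simp only [mem_union, mem_insert_iff, mem_singleton_iff, not_or] at htS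
    have htI : t ∈ Ioo (0 : ℝ) 1 \ S :=
      ⟨⟨lt_of_le_of_ne ht.1 (Ne.symm htS.2.1), lt_of_le_of_ne ht.2 htS.2.2⟩, htS.1⟩
    rw [(hder t htI).deriv]
    exact ofReal_div_le_kobayashiMetric f hf _ _

/-! ### Upper bound along the segment, and the resulting distance -/

theorem kobayashiMetric_smul_le {q : Seminorm ℂ E} {z : E} {r t : ℝ} (hr0 : 0 < r) (hr1 : r < 1)
    (hqz : q z ≤ r) (ht : t ∈ Icc (0 : ℝ) 1) :
    kobayashiMetric {x | q x < 1} (t • z) z ≤ ENNReal.ofReal (r / (1 - (t * r) ^ 2)) := by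
  set a : ℝ := t * r with ha
  have ha0 : 0 ≤ a := mul_nonneg ht.1 hr0.le
  have ha1 : a < 1 := by nlinarith [ht.2]
  have hpos : 0 < 1 - a ^ 2 := by nlinarith
  have hden : ∀ ζ ∈ Metric.ball (0 : ℂ) 1, 1 + a * ζ ≠ 0 := fun ζ hζ h => by
    have hζ' : ‖ζ‖ < 1 := by simpa using hζ
    have h1 : ‖(a : ℂ) * ζ‖ = 1 := by
      rw [show (a : ℂ) * ζ = -1 by linear_combination h]; simp
    rw [norm_mul, Complex.norm_real, Real.norm_of_nonneg ha0] at h1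
    nlinarith [norm_nonneg ζ]
  -- The disc `m ζ • z` has |m| < 1/r, so it stays in the ball; m(0) = t and m'(0) = (1 - a²)/r.
  -- Using `r ≥ q z` with `r > 0` allows the division even when `q z = 0`.
  set m : ℂ → ℂ := fun ζ => (ζ + a) / (1 + a * ζ) / r with hm
  have hm_an : AnalyticOnNhd ℂ m (Metric.ball 0 1) := by
    intro ζ hζ
    have h1 : AnalyticAt ℂ (fun ζ : ℂ => ζ + a) ζ := by fun_prop
    have h2 : AnalyticAt ℂ (fun ζ : ℂ => 1 + a * ζ) ζ := by fun_prop
    exact (h1.div h2 (hden ζ hζ)).div_const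
  have hrC : (r : ℂ) ≠ 0 := by exact_mod_cast hr0.ne'
  refine sInf_le ⟨(1 - a ^ 2) / r, fun ζ => m ζ • z, div_pos hpos hr0, ?_, ?_, ?_, ?_, ?_⟩
  · exact fun ζ hζ => (hm_an ζ hζ).smul analyticAt_const
  · intro ζ hζ
    have hζ' : ‖ζ‖ < 1 := by simpa using hζ
    have hlt : ‖(ζ + a) / (1 + a * ζ)‖ < 1 := by
      rw [norm_div, div_lt_one (norm_pos_iff.2 (hden ζ hζ)),
        ← sq_lt_sq₀ (norm_nonneg _) (norm_nonneg _)]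
      have hw2 : ‖ζ‖ ^ 2 < 1 := by nlinarith [norm_nonneg ζ]
      rw [Complex.sq_norm, Complex.normSq_apply] at hw2
      rw [Complex.sq_norm, Complex.sq_norm, Complex.normSq_apply, Complex.normSq_apply]
      simp only [Complex.add_re, Complex.add_im, Complex.mul_re, Complex.mul_im, Complex.ofReal_re,
        Complex.ofReal_im, Complex.one_re, Complex.one_im]
      -- |1 + aζ|² - |ζ + a|² = (1 - |ζ|²)(1 - a²).
      nlinarith [mul_pos (sub_pos.2 hw2) hpos]
    simp only [mem_ofPred_eq, map_smul_eq_mul, hm]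
    rw [norm_div, Complex.norm_real, Real.norm_of_nonneg hr0.le, div_mul_eq_mul_div,
      div_lt_one hr0]
    calc _ ≤ ‖(ζ + a) / (1 + a * ζ)‖ * r := by gcongr
      _ < 1 * r := by gcongr
      _ = r := one_mul r
  · have : m 0 = (t : ℂ) := by
      simp only [hm, ha]; push_cast; field_simp; ring
    simp only [this]
    exact Complex.coe_smul t z
  · have hmd : HasDerivAt m (((1 - a ^ 2) / r : ℝ) : ℂ) 0 := by
      have h1 : HasDerivAt (fun ζ : ℂ => ζ + a) 1 0 := (hasDerivAt_id _).add_const _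
      have h2 : HasDerivAt (fun ζ : ℂ => 1 + a * ζ) a 0 := by
        simpa using ((hasDerivAt_id (0 : ℂ)).const_mul (a : ℂ)).const_add 1
      have := (h1.div h2 (by simp)).div_const (r : ℂ)
      refine this.congr_deriv ?_
      push_cast; simp; ring
    have := hmd.smul_const z
    rwa [Complex.coe_smul] at this
  · rw [one_div_div]

theorem kobayashiDist_zero_le {q : Seminorm ℂ E} {z : E} {r : ℝ} (hr0 : 0 < r) (hr1 : r < 1)
    (hqz : q z ≤ r) :
    kobayashiDist {x | q x < 1} 0 z ≤ ENNReal.ofReal (Real.artanh r) := by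
  have hder : ∀ t : ℝ, deriv (fun t : ℝ => t • z) t = z := fun t => by
    simpa using ((hasDerivAt_id t).smul_const z).deriv
  refine sInf_le_of_le (b := ∫⁻ t in Icc (0 : ℝ) 1,
    kobayashiMetric {x | q x < 1} (t • z) (deriv (fun t : ℝ => t • z) t)) ⟨fun t => t • z, ⟨1, fun i => i, by simp, by simp, ?_⟩, ?_, by simp, by simp,
    rfl⟩ ?_
  · intro i _
    exact ⟨by simp, by fun_prop⟩
  · intro t ht
    have : q (t • z) = t * q z := by
      rw [← Complex.coe_smul, map_smul_eq_mul, Complex.norm_real, Real.norm_of_nonneg ht.1]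
    simp only [mem_ofPred_eq, this]
    nlinarith [ht.1, ht.2, apply_nonneg q z]
  · rw [← lintegral_artanh_deriv hr0.le hr1]
    refine setLIntegral_mono' measurableSet_Icc fun t ht => ?_
    rw [hder]
    exact kobayashiMetric_smul_le hr0 hr1 hqz ht

/-- The Kobayashi pseudodistance of the unit ball of a continuous seminorm from its centre. -/
theorem kobayashiDist_zero_eq {q : Seminorm ℂ E} (hq : Continuous q) {z : E} (hz : q z < 1) :
    kobayashiDist {x | q x < 1} 0 z = ENNReal.ofReal (Real.artanh (q z)) := by
  have h0 := apply_nonneg q z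
  apply le_antisymm
  · have hcont : Filter.Tendsto (fun r => ENNReal.ofReal (Real.artanh r)) (nhdsWithin (q z) (Ioi (q z)))
        (nhds (ENNReal.ofReal (Real.artanh (q z)))) :=
      (ENNReal.continuous_ofReal.continuousAt.comp
        (Real.hasDerivAt_artanh ⟨by linarith, hz⟩).continuousAt).tendsto.mono_left
        nhdsWithin_le_nhds
    -- The bound holds for each `r` in `(q z, 1)`; let `r` decrease to `q z`.
    refine ge_of_tendsto hcont ?_
    filter_upwards [Ioo_mem_nhdsGT hz] with r hr
    exact kobayashiDist_zero_le (h0.trans_lt hr.1) hr.2 hr.1.le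
  · obtain ⟨f, hfz, hf⟩ := Seminorm.exists_strongDual_apply_eq hq z
    have := ofReal_artanh_sub_le_kobayashiDist (D := {x | q x < 1}) f
      (fun x hx => (hf x).trans_lt hx) 0 z
    simpa [hfz] using this

/-- The **Schwarz lemma** for the unit ball of a continuous seminorm. -/
theorem seminorm_apply_le_of_mapsTo {q : Seminorm ℂ E} (hq : Continuous q) {g : E → E}
    (hg : AnalyticOnNhd ℂ g {x | q x < 1}) (hmaps : MapsTo g {x | q x < 1} {x | q x < 1})
    (hg0 : g 0 = 0) {w : E} (hw : q w < 1) : q (g w) ≤ q w := by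
  refine le_of_forall_gt_imp_ge_of_dense fun r hr => ?_
  rcases le_or_gt 1 r with h1 | h1
  · exact (le_of_lt (hmaps hw)).trans h1
  have hr0 : 0 < r := (apply_nonneg q w).trans_lt hr
  obtain ⟨f, hfz, hf⟩ := Seminorm.exists_strongDual_apply_eq hq (g w)
  have hmem : ∀ ζ ∈ Metric.ball (0 : ℂ) 1, (ζ / r) • w ∈ {x | q x < 1} := fun ζ hζ => by
    have hζ' : ‖ζ‖ < 1 := by simpa using hζ
    simp only [mem_ofPred_eq, map_smul_eq_mul, norm_div, Complex.norm_real,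
      Real.norm_of_nonneg hr0.le]
    rw [div_mul_eq_mul_div, div_lt_one hr0]
    nlinarith [norm_nonneg ζ, apply_nonneg q w]
  -- The one-variable Schwarz lemma on the disc through `w`, rescaled so that `w` is reached at `ζ =
  -- r`.
  have key := Complex.norm_le_norm_of_mapsTo_ball (f := fun ζ : ℂ => f (g ((ζ / r) • w)))
    (R := 1) (z := r) ?_ ?_ (by simp [hg0]) (by simpa [abs_of_pos hr0] using h1)
  · have hrC : (r : ℂ) ≠ 0 := by exact_mod_cast hr0.ne'
    simpa [div_self hrC, hfz, abs_of_pos hr0, abs_of_nonneg] using key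
  · intro ζ hζ
    have h2 : DifferentiableAt ℂ (fun ζ : ℂ => (ζ / r) • w) ζ := by fun_prop
    exact (f.differentiableAt.comp ζ
      ((hg _ (hmem ζ hζ)).differentiableAt.comp ζ h2)).differentiableWithinAt
  · intro ζ hζ
    simpa using ((hf _).trans_lt (hmaps (hmem ζ hζ))).le

/-! ### Automorphisms fixing the centre preserve the seminorm -/

theorem IsAutomorphism.mapsTo {D : Set E} {φ : PartialEquiv E E} (h : IsAutomorphism D φ) :
    MapsTo φ D D := by
  have := φ.mapsTo
  rwa [h.source_eq, h.target_eq] at this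

theorem IsAutomorphism.mapsTo_symm {D : Set E} {φ : PartialEquiv E E} (h : IsAutomorphism D φ) :
    MapsTo φ.symm D D := by
  have := φ.mapsTo_symm
  rwa [h.source_eq, h.target_eq] at this

theorem IsAutomorphism.seminorm_apply_eq {q : Seminorm ℂ E} (hq : Continuous q)
    {φ : PartialEquiv E E} (h : IsAutomorphism {x | q x < 1} φ) (h0 : φ 0 = 0) {w : E}
    (hw : q w < 1) : q (φ w) = q w ∧ q (φ.symm w) = q w := by
  have h0D : (0 : E) ∈ {x | q x < 1} := by simp
  have h0' : φ.symm 0 = 0 := by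
    have := φ.left_inv (h.source_eq.symm ▸ h0D)
    rwa [h0] at this
  have key : ∀ v : E, q v < 1 → q (φ v) ≤ q v := fun v hv =>
    seminorm_apply_le_of_mapsTo hq h.holomorphic h.mapsTo h0 hv
  have key' : ∀ v : E, q v < 1 → q (φ.symm v) ≤ q v := fun v hv =>
    seminorm_apply_le_of_mapsTo hq h.holomorphic_symm h.mapsTo_symm h0' hv
  have hl : φ.symm (φ w) = w := φ.left_inv (h.source_eq.symm ▸ hw)
  have hr : φ (φ.symm w) = w := φ.right_inv (h.target_eq.symm ▸ hw)
  constructor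
  · refine le_antisymm (key w hw) ?_
    simpa [hl] using key' (φ w) (h.mapsTo hw)
  · refine le_antisymm (key' w hw) ?_
    simpa [hr] using key (φ.symm w) (h.mapsTo_symm hw)

theorem seminorm_scalarMul {q : Seminorm ℂ E} (hq : Continuous q) {φ : E → PartialEquiv E E}
    (h : IsAutomorphism {x | q x < 1} (φ 0)) (h0 : φ 0 0 = 0) {w : E} (hw : q w < 1) {a : ℝ}
    (ha : a ∈ Icc (0 : ℝ) 1) : q (scalarMul φ 0 a w) = a * q w := by
  have e : q (a • φ 0 w) = a * q w := by
    rw [← Complex.coe_smul, map_smul_eq_mul, Complex.norm_real, Real.norm_of_nonneg ha.1,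
      (h.seminorm_apply_eq hq h0 hw).1]
  have hlt : q (a • φ 0 w) < 1 := by
    rw [e]; nlinarith [ha.1, ha.2, apply_nonneg q w]
  rw [scalarMul, (h.seminorm_apply_eq hq h0 hlt).2, e]

/-! ### Solving the defining equation -/

theorem _root_.Real.tanh_mul_artanh {s : ℝ} (hs : s ∈ Ioo (-1) 1) (t : ℝ) :
    Real.tanh (t * Real.artanh s) =
      ((1 + s) ^ t - (1 - s) ^ t) / ((1 + s) ^ t + (1 - s) ^ t) := by
  have h1 : 0 < 1 + s := by linarith [hs.1]
  have h2 : 0 < 1 - s := by linarith [hs.2]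
  set A := Real.log (1 + s) with hA
  set B := Real.log (1 - s) with hB
  have e : t * Real.artanh s = t * (A - B) / 2 := by
    rw [Real.artanh_eq_half_log (Ioo_subset_Icc_self hs), Real.log_div h1.ne' h2.ne']; ring
  -- (1 ± s)^t = (1 - s²)^(t/2) · exp(± t artanh s); the common factor cancels in the quotient.
  have ea : (1 + s) ^ t = Real.exp (t * (A + B) / 2) * Real.exp (t * (A - B) / 2) := by
    rw [Real.rpow_def_of_pos h1, ← Real.exp_add]; congr 1; ring
  have eb : (1 - s) ^ t = Real.exp (t * (A + B) / 2) * Real.exp (-(t * (A - B) / 2)) := by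
    rw [Real.rpow_def_of_pos h2, ← Real.exp_add]; congr 1; ring
  rw [e, ea, eb, Real.tanh_eq, ← mul_sub, ← mul_add, mul_div_mul_left _ _ (Real.exp_ne_zero _)]

theorem ofReal_artanh_eq_mul_iff {p s t : ℝ} (hp : p ∈ Ico (0 : ℝ) 1) (hs : s ∈ Ico (0 : ℝ) 1)
    (ht : 0 ≤ t) :
    ENNReal.ofReal (Real.artanh p) = ENNReal.ofReal t * ENNReal.ofReal (Real.artanh s) ↔
      p = Real.tanh (t * Real.artanh s) := by
  rw [← ENNReal.ofReal_mul ht, ENNReal.ofReal_eq_ofReal_iff (Real.artanh_nonneg hp.1)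
    (mul_nonneg ht (Real.artanh_nonneg hs.1))]
  constructor
  · intro h
    rw [← h, Real.tanh_artanh ⟨by linarith [hp.1], hp.2⟩]
  · rintro rfl
    exact Real.artanh_tanh _

theorem solvesGeodesicEquation_iff {q : Seminorm ℂ E} (hq : Continuous q)
    {φ : E → PartialEquiv E E} (h : IsAutomorphism {x | q x < 1} (φ 0)) (h0 : φ 0 0 = 0) {x y : E}
    (hw : q (φ x y) < 1) (α : ℝ → ℝ) :
    SolvesGeodesicEquation (kobayashiDist {x | q x < 1}) φ 0 x y α ↔
      MapsTo α (Icc 0 1) (Icc 0 1) ∧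
        ∀ t ∈ Icc (0 : ℝ) 1,
          q (scalarMul φ 0 (α t) (φ x y)) = Real.tanh (t * Real.artanh (q (φ x y))) := by
  refine and_congr_right fun hα => forall₂_congr fun t ht => ?_
  have e := seminorm_scalarMul hq h h0 hw (hα ht)
  have hs0 := apply_nonneg q (φ x y)
  have hlt : q (scalarMul φ 0 (α t) (φ x y)) < 1 := by
    rw [e]; nlinarith [(hα ht).1, (hα ht).2]
  rw [kobayashiDist_zero_eq hq hlt, kobayashiDist_zero_eq hq hw]
  exact ofReal_artanh_eq_mul_iff ⟨apply_nonneg q _, hlt⟩ ⟨hs0, hw⟩ ht.1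

/-- The upper bound `s` ensures that the explicit `α` takes values in `[0,1]`. -/
theorem tanh_mul_artanh_mem_Icc {s t : ℝ} (hs : s ∈ Ico (0 : ℝ) 1) (ht : t ∈ Icc (0 : ℝ) 1) :
    Real.tanh (t * Real.artanh s) ∈ Icc 0 s := by
  have hA := Real.artanh_nonneg hs.1
  have hs' : s ∈ Ioo (-1 : ℝ) 1 := ⟨by linarith [hs.1], hs.2⟩
  have hT : Real.tanh (t * Real.artanh s) ∈ Ioo (-1 : ℝ) 1 :=
    ⟨Real.neg_one_lt_tanh _, Real.tanh_lt_one _⟩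
  constructor
  · rw [← Real.artanh_le_artanh_iff ⟨by norm_num, by norm_num⟩ hT, Real.artanh_zero,
      Real.artanh_tanh]
    exact mul_nonneg ht.1 hA
  · rw [← Real.artanh_le_artanh_iff hT hs', Real.artanh_tanh]
    nlinarith [ht.2]

theorem solvesGeodesicEquation_iff_eq {q : Seminorm ℂ E} (hq : Continuous q)
    {φ : E → PartialEquiv E E} (h : IsAutomorphism {x | q x < 1} (φ 0)) (h0 : φ 0 0 = 0) {x y : E}
    (hw : q (φ x y) < 1) (hpos : 0 < q (φ x y)) (α : ℝ → ℝ) :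
    SolvesGeodesicEquation (kobayashiDist {x | q x < 1}) φ 0 x y α ↔
      ∀ t ∈ Icc (0 : ℝ) 1,
        α t = 1 / q (φ x y) * Real.tanh (t * Real.artanh (q (φ x y))) := by
  rw [solvesGeodesicEquation_iff hq h h0 hw]
  constructor
  · rintro ⟨hα, H⟩ t ht
    rw [← H t ht, seminorm_scalarMul hq h h0 hw (hα ht)]
    field_simp
  · intro H
    have hα : MapsTo α (Icc 0 1) (Icc 0 1) := fun t ht => by
      obtain ⟨h1, h2⟩ := tanh_mul_artanh_mem_Icc ⟨hpos.le, hw⟩ ht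
      rw [H t ht, one_div_mul_eq_div]
      exact ⟨div_nonneg h1 hpos.le, (div_le_one hpos).2 h2⟩
    refine ⟨hα, fun t ht => ?_⟩
    rw [seminorm_scalarMul hq h h0 hw (hα ht), H t ht]
    field_simp

theorem exists_continuous_solvesGeodesicEquation {q : Seminorm ℂ E} (hq : Continuous q)
    {φ : E → PartialEquiv E E} (h : IsAutomorphism {x | q x < 1} (φ 0)) (h0 : φ 0 0 = 0) {x y : E}
    (hw : q (φ x y) < 1) :
    ∃ α : ℝ → ℝ, Continuous α ∧ α 0 = 0 ∧ α 1 = 1 ∧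
      SolvesGeodesicEquation (kobayashiDist {x | q x < 1}) φ 0 x y α := by
  rcases (apply_nonneg q (φ x y)).eq_or_lt with hs | hs
  · refine ⟨id, continuous_id, rfl, rfl, (solvesGeodesicEquation_iff hq h h0 hw id).2
      ⟨mapsTo_id _, fun t ht => ?_⟩⟩
    rw [id, seminorm_scalarMul hq h h0 hw ht, ← hs]
    simp
  · refine ⟨fun t => 1 / q (φ x y) * Real.tanh (t * Real.artanh (q (φ x y))), ?_, by simp, ?_,
      (solvesGeodesicEquation_iff_eq hq h h0 hw hs _).2 fun t _ => rfl⟩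
    · have : Continuous Real.tanh := by
        rw [show Real.tanh = fun x => Real.sinh x / Real.cosh x from
          funext Real.tanh_eq_sinh_div_cosh]
        exact Real.continuous_sinh.div Real.continuous_cosh fun x => (Real.cosh_pos x).ne'
      exact continuous_const.mul (this.comp (continuous_id.mul continuous_const))
    · simp only [one_mul]
      rw [Real.tanh_artanh ⟨by linarith, hw⟩, one_div_mul_cancel hs.ne']

end ComplexDomain

theorem proposition5p2 {E : Type*} [NormedAddCommGroup E] [NormedSpace ℂ E]
    (q : Seminorm ℂ E) (hq : Continuous q)
    (D : Set E) (hD : D = {x : E | q x < 1})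
    (φ : E → PartialEquiv E E)
    (hφ : ∀ x ∈ D, ComplexDomain.IsAutomorphism D (φ x))
    (hφ_zero : ∀ x ∈ D, φ x x = 0)
    (x y : E) (hx : x ∈ D) (hy : y ∈ D)
    (s : ℝ) (hs : s = q (φ x y)) :
    -- a continuous solution exists for which the almost geodesic runs in `D` from `x` to `y`
    (∃ α : ℝ → ℝ, ContinuousOn α (Set.Icc 0 1) ∧
      ComplexDomain.SolvesGeodesicEquation (ComplexDomain.kobayashiDist D) φ 0 x y α ∧
      Set.MapsTo (ComplexDomain.geodesicCurve φ 0 x y α) (Set.Icc 0 1) D ∧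
      ComplexDomain.geodesicCurve φ 0 x y α 0 = x ∧
      ComplexDomain.geodesicCurve φ 0 x y α 1 = y) ∧
    -- the solutions are the functions `α : [0,1] → [0,1]` satisfying the stated formula
    (∀ α : ℝ → ℝ,
      ComplexDomain.SolvesGeodesicEquation (ComplexDomain.kobayashiDist D) φ 0 x y α ↔
        Set.MapsTo α (Set.Icc 0 1) (Set.Icc 0 1) ∧
        ∀ t ∈ Set.Icc (0 : ℝ) 1,
          q (ComplexDomain.scalarMul φ 0 (α t) (φ x y)) =
            ((1 + s) ^ t - (1 - s) ^ t) / ((1 + s) ^ t + (1 - s) ^ t)) ∧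
    -- the almost geodesics are the curves given by such functions
    (∀ γ : ℝ → E,
      ComplexDomain.IsAlmostGeodesic (ComplexDomain.kobayashiDist D) φ 0 x y γ ↔
        ∃ α : ℝ → ℝ, Set.MapsTo α (Set.Icc 0 1) (Set.Icc 0 1) ∧
          ∀ t ∈ Set.Icc (0 : ℝ) 1,
            γ t = (φ x).symm (ComplexDomain.scalarMul φ 0 (α t) (φ x y)) ∧
            q (ComplexDomain.scalarMul φ 0 (α t) (φ x y)) =
              ((1 + s) ^ t - (1 - s) ^ t) / ((1 + s) ^ t + (1 - s) ^ t)) ∧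
    -- the explicit formula, when `φ_0` commutes with the scalars in `[0,1]`
    ((∀ w ∈ D, ∀ t ∈ Set.Icc (0 : ℝ) 1, φ 0 (t • w) = t • φ 0 w) → 0 < s →
      ∀ α : ℝ → ℝ,
        (ComplexDomain.SolvesGeodesicEquation (ComplexDomain.kobayashiDist D) φ 0 x y α ↔
          ∀ t ∈ Set.Icc (0 : ℝ) 1,
            α t = 1 / s * (((1 + s) ^ t - (1 - s) ^ t) / ((1 + s) ^ t + (1 - s) ^ t)))) := by
  subst hD
  have hball : (0 : E) ∈ {x : E | q x < 1} := by simp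
  have h := hφ 0 hball
  have h0 := hφ_zero 0 hball
  have hxaut := hφ x hx
  have hw : q (φ x y) < 1 := hxaut.mapsTo hy
  have hs' : s ∈ Set.Ioo (-1 : ℝ) 1 := by
    rw [hs]; exact ⟨by linarith [apply_nonneg q (φ x y)], hw⟩
  have hformula : ∀ α : ℝ → ℝ,
      ComplexDomain.SolvesGeodesicEquation (ComplexDomain.kobayashiDist {x : E | q x < 1})
        φ 0 x y α ↔
        Set.MapsTo α (Set.Icc 0 1) (Set.Icc 0 1) ∧
        ∀ t ∈ Set.Icc (0 : ℝ) 1,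
          q (ComplexDomain.scalarMul φ 0 (α t) (φ x y)) =
            ((1 + s) ^ t - (1 - s) ^ t) / ((1 + s) ^ t + (1 - s) ^ t) := fun α => by
    rw [ComplexDomain.solvesGeodesicEquation_iff hq h h0 hw α, ← hs]
    simp only [Real.tanh_mul_artanh hs']
  refine ⟨?_, hformula, fun γ => ?_, fun _ hspos α => ?_⟩
  · obtain ⟨α, hαc, hα0, hα1, hα⟩ :=
      ComplexDomain.exists_continuous_solvesGeodesicEquation hq h h0 hw
    refine ⟨α, hαc.continuousOn, hα, fun t ht => hxaut.mapsTo_symm ?_, ?_, ?_⟩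
    · rw [Set.mem_ofPred_eq, ComplexDomain.seminorm_scalarMul hq h h0 hw (hα.1 ht)]
      nlinarith [(hα.1 ht).1, (hα.1 ht).2, apply_nonneg q (φ x y)]
    -- Since `φ 0` fixes `0`, `0 ⊗ φ x y = 0 = φ x x`.
    · have e : (φ 0).symm 0 = 0 := by
        have := (φ 0).left_inv (h.source_eq.symm ▸ hball)
        rwa [h0] at this
      rw [ComplexDomain.geodesicCurve, hα0, ComplexDomain.scalarMul, zero_smul, e,
        ← hφ_zero x hx]
      exact (φ x).left_inv (hxaut.source_eq.symm ▸ hx)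
    · rw [ComplexDomain.geodesicCurve, hα1, ComplexDomain.scalarMul, one_smul,
        (φ 0).left_inv (h.source_eq.symm ▸ hw)]
      exact (φ x).left_inv (hxaut.source_eq.symm ▸ hy)
  · constructor
    · rintro ⟨α, hα, hγ⟩
      obtain ⟨hmaps, hα'⟩ := (hformula α).1 hα
      exact ⟨α, hmaps, fun t ht => ⟨hγ t ht, hα' t ht⟩⟩
    · rintro ⟨α, hmaps, H⟩
      exact ⟨α, (hformula α).2 ⟨hmaps, fun t ht => (H t ht).2⟩, fun t ht => (H t ht).1⟩
  · rw [ComplexDomain.solvesGeodesicEquation_iff_eq hq h h0 hw (hs ▸ hspos) α, ← hs]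
    simp only [Real.tanh_mul_artanh hs']
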